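/- Let $G=(V,E)$ be a finite simple graph. A \emph{harmonious total colouring} of $G$ is a map $c$ from $V\cup E$ to a set of colours such that adjacent vertices, distinct edges sharing an end, and incident vertices and edges receive different colours, and such that each unordered pair of colours occurs as $\{c(v),c(e)\}$ for at most one pair $(v,e)$ consisting of a vertex $v$ and an edge $e$ incident with $v$. The \emph{harmonious total chromatic number} $h_t(G)$ is the smallest number of colours for which such a colouring exists. Let $K_n$ be the complete graph on $n$ vertices. Then $$h_t(K_n)=\left\lceil \tfrac{3}{2}n\right\rceil \quad\text{for every natural number } n\neq 1,4,$$ while $h_t(K_1)=1$ and $h_t(K_4)=7$. -/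

import Mathlib

/-- A harmonious total colouring of a simple graph `G` with colours in `C`: the vertices and the
edges of `G` are coloured so that adjacent vertices, adjacent edges (distinct edges sharing an end),
and incident vertices and edges receive different colours, and no unordered pair of colours occurs
on more than one incident vertex-edge pair. -/
structure HarmoniousTotalColouring {V : Type*} (G : SimpleGraph V) (C : Type*) where
  /-- The colour of a vertex. -/
  vertexColour : V → C
  /-- The colour of an edge. -/
  edgeColour : G.edgeSet → C
  vertex_proper : ∀ v w : V, G.Adj v w → vertexColour v ≠ vertexColour w
  edge_proper : ∀ e f : G.edgeSet, e ≠ f → ∀ v : V, v ∈ (e : Sym2 V) → v ∈ (f : Sym2 V) →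
    edgeColour e ≠ edgeColour f
  incident_proper : ∀ (v : V) (e : G.edgeSet), v ∈ (e : Sym2 V) → vertexColour v ≠ edgeColour e
  harmonious : ∀ (v w : V) (e f : G.edgeSet), v ∈ (e : Sym2 V) → w ∈ (f : Sym2 V) →
    s(vertexColour v, edgeColour e) = s(vertexColour w, edgeColour f) → v = w ∧ e = f

/-- The harmonious total chromatic number of `G`: the least `k` such that `G` has a harmonious
total colouring with `k` colours (`⊤` if there is no such natural number, which cannot happen for a
finite graph). -/
noncomputable def harmoniousTotalChromaticNumber {V : Type*} (G : SimpleGraph V) : ℕ∞ :=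
  ⨅ k ∈ {k : ℕ | Nonempty (HarmoniousTotalColouring G (Fin k))}, (k : ℕ∞)

/-! Lower bound (`three_mul_le`). The vertices use `n` distinct colours. Send an ordered pair `(u,
v)` whose edge has the colour of a vertex `w` to `(u, w)`. This is injective, and harmony makes the
image disjoint from its transpose, so at most half of the edges carry vertex colours. The remaining
edges share `k - n` extra colours, each of which is a matching with at most `n / 2` edges; comparing
the counts gives the bound.

Upper bound. Edges are coloured by elements of `V ⊕ X`, where `V` is the vertex set and `X` is a set
of extra colours. Harmony then says that no edge at `u` has colour `w` while an edge at `w` has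
colour `u`. For `n = 4r + 2` take two copies of a set `R` of odd order with midpoints. For `i ≠ j`
with midpoint `m`, a sign rule gives half of the four edges between the copies of `i` and of `j` the
vertex colours `(m, ±)` and the other half the extra colour `m`; a tournament on `R` supplies the
signs and hence harmony. Orders `4r + 3` and `4r + 1` come from adding a point, or from merging the
two copies of one point.

A finite commutative idempotent quasigroup has odd order, so multiples of four need another table,
built on two copies of the residues modulo `2t`. It works for `t ≥ 4`; orders 8 and 12 have explicit
tables, and order 4 is a genuine exception (`six_lt_of_colouring_four`). -/

/-- A symmetric table of colours on ordered pairs of distinct points, in which every point is its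
own colour, gives a harmonious total colouring of the complete graph. -/
theorem nonempty_colouring_of_table {V X : Type*} [Fintype V] [Fintype X] {n k : ℕ}
    (hV : Fintype.card V = n) (hk : Fintype.card V + Fintype.card X = k) (col : V → V → V ⊕ X)
    (symm : ∀ u v, col u v = col v u) (incident : ∀ u v, u ≠ v → col u v ≠ Sum.inl u)
    (proper : ∀ u v w, u ≠ v → u ≠ w → col u v = col u w → v = w)
    (harm : ∀ u u' w w', u ≠ u' → w ≠ w' → col u u' = Sum.inl w → col w w' ≠ Sum.inl u) :
    Nonempty (HarmoniousTotalColouring (SimpleGraph.completeGraph (Fin n)) (Fin k)) := by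
  classical
  let f : Fin n ≃ V := (Fintype.equivFinOfCardEq hV).symm
  let g : V ⊕ X ≃ Fin k := Fintype.equivFinOfCardEq (by rw [Fintype.card_sum, hk])
  let c : Sym2 (Fin n) → Fin k :=
    Sym2.lift ⟨fun u v => g (col (f u) (f v)), fun u v => by simp only [symm]⟩
  have hc : ∀ u v, c s(u, v) = g (col (f u) (f v)) := fun u v => rfl
  have hmem : ∀ (v : Fin n) (e : (SimpleGraph.completeGraph (Fin n)).edgeSet), v ∈ (e : Sym2 (Fin n)) →
      ∃ w, v ≠ w ∧ (e : Sym2 (Fin n)) = s(v, w) := by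
    rintro v ⟨e, he⟩ hv
    obtain ⟨w, rfl⟩ := hv
    exact ⟨w, by simpa using he, rfl⟩
  have hedge : ∀ (v : Fin n) (e e' : (SimpleGraph.completeGraph (Fin n)).edgeSet),
      v ∈ (e : Sym2 (Fin n)) → v ∈ (e' : Sym2 (Fin n)) → c e = c e' → e = e' := by
    intro v e e' he he' h
    obtain ⟨w, hw, hew⟩ := hmem v e he
    obtain ⟨w', hw', hew'⟩ := hmem v e' he'
    rw [hew, hew', hc, hc] at h
    have := f.injective (proper _ _ _ (f.injective.ne hw) (f.injective.ne hw') (g.injective h))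
    exact Subtype.ext (by rw [hew, hew', this])
  refine ⟨⟨fun v => g (Sum.inl (f v)), fun e => c e, ?_, ?_, ?_, ?_⟩⟩
  · intro v w hvw h
    exact hvw (f.injective (Sum.inl_injective (g.injective h)))
  · intro e e' hne v he he' h
    exact hne (hedge v e e' he he' h)
  · intro v e he h
    obtain ⟨w, hw, hew⟩ := hmem v e he
    rw [hew, hc] at h
    exact incident _ _ (f.injective.ne hw) (g.injective h).symm
  · intro v w e e' he he' h
    rcases Sym2.eq_iff.1 h with ⟨h1, h2⟩ | ⟨h1, h2⟩
    · obtain rfl := f.injective (Sum.inl_injective (g.injective h1))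
      exact ⟨rfl, hedge v e e' he he' h2⟩
    · obtain ⟨x, hx, hex⟩ := hmem v e he
      obtain ⟨y, hy, hey⟩ := hmem w e' he'
      rw [hey, hc] at h1
      rw [hex, hc] at h2
      exact absurd (g.injective h1).symm
        (harm _ _ _ _ (f.injective.ne hx) (f.injective.ne hy) (g.injective h2))

/-! ### Order 2 modulo 4: midpoints with signs. -/

/-- A commutative idempotent cancellative operation together with a tournament. -/
structure MidpointSystem (R : Type*) where
  mid : R → R → R
  mid_comm : ∀ i j, mid i j = mid j i
  mid_self : ∀ i, mid i i = i
  mid_cancel : ∀ i j k, mid i j = mid i k → j = k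
  sgn : R → R → Bool
  sgn_ne : ∀ i k, i ≠ k → sgn i k ≠ sgn k i

namespace MidpointSystem

theorem exists_of_odd {m : ℕ} (hm : Odd m) : Nonempty (MidpointSystem (ZMod m)) := by
  obtain ⟨s, rfl⟩ := hm
  -- `-s` is the inverse of two, so multiplying by it halves a sum.
  have h2 : (2 : ZMod (2 * s + 1)) * (-s) = 1 := by
    have : ((2 * s + 1 : ℕ) : ZMod (2 * s + 1)) = 0 := ZMod.natCast_self _
    push_cast at this
    linear_combination -this
  refine ⟨⟨fun i j => (i + j) * (-s), fun i j => congrArg (· * _) (add_comm i j), fun i => ?_, fun i j k h => ?_,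
    fun i j => decide (i.val < j.val), fun i k hik => ?_⟩⟩
  · linear_combination i * h2
  · change (i + j) * (-s : ZMod (2 * s + 1)) = (i + k) * (-s) at h
    linear_combination 2 * h + (k - j) * h2
  · have := (ZMod.val_injective (2 * s + 1)).ne hik
    rw [Ne, decide_eq_decide]
    omega

variable {R : Type*} (S : MidpointSystem R)

theorem eq_of_mid_eq_left {i j : R} (h : S.mid i j = i) : i = j :=
  S.mid_cancel i i j (by rw [S.mid_self, h])

theorem eq_of_mid_eq_right {i j : R} (h : S.mid i j = j) : i = j :=
  (S.eq_of_mid_eq_left (by rw [S.mid_comm, h])).symm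

variable [DecidableEq R]

/-- The table of colours on two copies of the points. -/
def table (u v : R × Bool) : (R × Bool) ⊕ R :=
  if u.1 = v.1 then Sum.inr u.1
  else if (u.2 ^^ S.sgn u.1 (S.mid u.1 v.1)) = (v.2 ^^ S.sgn v.1 (S.mid u.1 v.1)) then
    Sum.inl (S.mid u.1 v.1, u.2 ^^ S.sgn u.1 (S.mid u.1 v.1))
  else Sum.inr (S.mid u.1 v.1)

theorem table_comm (u v : R × Bool) : S.table u v = S.table v u := by
  unfold table
  have := S.mid_comm
  grind

theorem table_eq_inl {u v w : R × Bool} (h : S.table u v = Sum.inl w) :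
    u.1 ≠ v.1 ∧ w.1 = S.mid u.1 v.1 ∧ w.2 = (u.2 ^^ S.sgn u.1 w.1) ∧
      w.2 = (v.2 ^^ S.sgn v.1 w.1) := by
  unfold table at h
  grind

theorem table_eq_inr {u v : R × Bool} {k : R} (h : S.table u v = Sum.inr k) (huv : u ≠ v) :
    k = S.mid u.1 v.1 ∧ v.2 = (!u.2 ^^ S.sgn u.1 k ^^ S.sgn v.1 k) := by
  unfold table at h
  have := S.mid_self
  have := Prod.ext_iff (x := u) (y := v)
  grind

theorem table_inl_fst_ne {u v w : R × Bool} (h : S.table u v = Sum.inl w) : u.1 ≠ w.1 := by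
  obtain ⟨h1, h2, -⟩ := S.table_eq_inl h
  intro h3
  exact h1 (S.eq_of_mid_eq_left (by rw [← h2, ← h3]))

/-- Either kind of colour reveals the midpoint, hence by cancellation the other first coordinate;
the sign rule then determines the other bit. -/
theorem table_proper {u v w : R × Bool} (hv : u ≠ v) (hw : u ≠ w)
    (h : S.table u v = S.table u w) : v = w := by
  rcases hc : S.table u w with c | c
  · rw [hc] at h
    obtain ⟨-, h1, h2, h3⟩ := S.table_eq_inl h
    obtain ⟨-, h1', h2', h3'⟩ := S.table_eq_inl hc
    have := S.mid_cancel _ _ _ (h1.symm.trans h1')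
    refine Prod.ext this ?_
    rw [this] at h3
    exact Bool.xor_left_inj.1 (h3.symm.trans h3')
  · rw [hc] at h
    obtain ⟨h1, h2⟩ := S.table_eq_inr h hv
    obtain ⟨h1', h2'⟩ := S.table_eq_inr hc hw
    have := S.mid_cancel _ _ _ (h1.symm.trans h1')
    exact Prod.ext this (by rw [h2, h2', this])

/-- If `(i, a)` sees `(k, c)` then `c = a ^^ sgn i k`. Seeing each other would also force `a = c ^^
sgn k i`, hence `sgn i k = sgn k i`, against the tournament. -/
theorem table_harm {u u' w w' : R × Bool} (h : S.table u u' = Sum.inl w) :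
    S.table w w' ≠ Sum.inl u := by
  intro h'
  have hne := S.table_inl_fst_ne h
  have h1 := (S.table_eq_inl h).2.2.1
  have h2 := (S.table_eq_inl h').2.2.1
  have h3 := S.sgn_ne _ _ hne
  grind

theorem nonempty_colouring [Fintype R] (S : MidpointSystem R) {n k : ℕ} (hn : 2 * Fintype.card R = n)
    (hk : 3 * Fintype.card R = k) :
    Nonempty (HarmoniousTotalColouring (SimpleGraph.completeGraph (Fin n)) (Fin k)) := by
  refine nonempty_colouring_of_table (V := R × Bool) (X := R) ?_ ?_ S.table S.table_comm ?_ ?_ ?_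
  · simp; omega
  · simp; omega
  · intro u v _ h
    exact S.table_inl_fst_ne h rfl
  · exact fun u v w hv hw h => S.table_proper hv hw h
  · exact fun u u' w w' _ _ h => S.table_harm h

/-! ### Order 3 modulo 4: one further point. -/

/-- The table of colours on two copies of the points and one further point. -/
def tableAdd : Option (R × Bool) → Option (R × Bool) → Option (R × Bool) ⊕ Option R
  | none, none => Sum.inr none
  | none, some (i, a) => if a then Sum.inr (some i) else Sum.inl (some (i, true))
  | some (i, a), none => if a then Sum.inr (some i) else Sum.inl (some (i, true))
  | some u, some v => if u.1 = v.1 then Sum.inr none else (S.table u v).map some some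

/-- The twin edges `(i, false)(i, true)` move to the new extra colour `none`, which frees the colour
`i` at both ends. The new point uses it towards `(i, true)`, and uses the vertex colour `(i, true)`
towards `(i, false)`, where no colour with first coordinate `i` occurred. The colour of the new
point itself is on no edge. -/
theorem nonempty_colouring_add [Fintype R] (S : MidpointSystem R) {n k : ℕ} (hn : 2 * Fintype.card R + 1 = n)
    (hk : 3 * Fintype.card R + 2 = k) :
    Nonempty (HarmoniousTotalColouring (SimpleGraph.completeGraph (Fin n)) (Fin k)) := by
  have hl : ∀ {u v w : R × Bool}, S.table u v = Sum.inl w → u.1 ≠ w.1 := S.table_inl_fst_ne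
  have hr : ∀ {u v : R × Bool}, u.1 ≠ v.1 → S.table u v ≠ Sum.inr u.1 := by
    intro u v hne h
    exact hne (S.eq_of_mid_eq_left (S.table_eq_inr h (fun h => hne (h ▸ rfl))).1.symm)
  have hp : ∀ {u v w : R × Bool}, u.1 ≠ v.1 → u.1 ≠ w.1 → S.table u v = S.table u w → v = w :=
    fun hv hw h => S.table_proper (fun h => hv (h ▸ rfl)) (fun h => hw (h ▸ rfl)) h
  have hh : ∀ {u u' w w' : R × Bool}, S.table u u' = Sum.inl w → S.table w w' ≠ Sum.inl u :=
    S.table_harm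
  have hmap : ∀ x y : (R × Bool) ⊕ R, x.map some some = y.map some some → x = y :=
    fun x y h => (Sum.map_injective.2 ⟨Option.some_injective _, Option.some_injective _⟩) h
  have hs : ∀ {u v w : R × Bool}, u.1 = v.1 → u.1 = w.1 → some u ≠ some v →
      some u ≠ some w → some v = some w := by
    rintro ⟨i, a⟩ ⟨j, b⟩ ⟨k, c⟩
    simp only
    rintro rfl rfl
    cases a <;> cases b <;> cases c <;> simp
  have hmapl : ∀ (x : (R × Bool) ⊕ R) (w : Option (R × Bool)), x.map some some = Sum.inl w →
      ∃ z, w = some z ∧ x = Sum.inl z := by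
    rintro (x | x) w h
    · exact ⟨x, (Sum.inl_injective h).symm, rfl⟩
    · exact absurd h Sum.inr_ne_inl
  have hmapr : ∀ (x : (R × Bool) ⊕ R) (w : Option R), x.map some some = Sum.inr w →
      ∃ z, w = some z ∧ x = Sum.inr z := by
    rintro (x | x) w h
    · exact absurd h Sum.inl_ne_inr
    · exact ⟨x, (Sum.inr_injective h).symm, rfl⟩
  refine nonempty_colouring_of_table (V := Option (R × Bool)) (X := Option R) ?_ ?_
    S.tableAdd ?_ ?_ ?_ ?_
  · simp only [Fintype.card_option, Fintype.card_prod, Fintype.card_bool]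
    omega
  · simp only [Fintype.card_option, Fintype.card_prod, Fintype.card_bool]
    omega
  · rintro (_ | u) (_ | v)
    · rfl
    · rfl
    · rfl
    · rw [tableAdd, tableAdd, S.table_comm u v, if_congr eq_comm rfl rfl]
  · rintro (_ | u) (_ | v) huv h <;> simp only [tableAdd] at h <;> grind
  · rintro (_ | u) (_ | v) (_ | w) huv huw h <;> simp only [tableAdd] at h <;> grind
  · rintro (_ | u) (_ | u') (_ | w) (_ | w') huv huw h h' <;> simp only [tableAdd] at h h' <;> grind

end MidpointSystem

/-! ### Order 1 modulo 4: merging two twin points. -/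

namespace MidpointSystem

variable {R : Type*} [DecidableEq R] (S : MidpointSystem R) (o : R)

/-- The midpoint with the distinguished point `o`. -/
def half (i : {i : R // i ≠ o}) : {i : R // i ≠ o} :=
  ⟨S.mid i o, fun h => i.2 (S.eq_of_mid_eq_right h)⟩

/-- The table of colours on two copies of the points other than `o`, the two copies of `o` being
merged to a single point. -/
def tableMerge (L : {i : R // i ≠ o} → {i : R // i ≠ o} → {i : R // i ≠ o}) :
    Option ({i : R // i ≠ o} × Bool) → Option ({i : R // i ≠ o} × Bool) →
      Option ({i : R // i ≠ o} × Bool) ⊕ Option {i : R // i ≠ o}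
  | none, none => Sum.inr none
  | none, some (i, a) => Sum.inl (some (S.half o i, a ^^ S.sgn i (S.half o i)))
  | some (i, a), none => Sum.inl (some (S.half o i, a ^^ S.sgn i (S.half o i)))
  | some (i, a), some (j, b) =>
    if i = j then Sum.inr (some (L i i))
    else if h : S.mid i j = o then if a = b then Sum.inr none else Sum.inr (some (L i j))
    else if (a ^^ S.sgn i (S.mid i j)) = (b ^^ S.sgn j (S.mid i j)) then
      Sum.inl (some (⟨S.mid i j, h⟩, a ^^ S.sgn i (S.mid i j)))
    else Sum.inr (some (L i j))

variable {o} {L : {i : R // i ≠ o} → {i : R // i ≠ o} → {i : R // i ≠ o}}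

theorem tableMerge_comm (hL : ∀ i j, L i j = L j i) (u v : Option ({i : R // i ≠ o} × Bool)) :
    S.tableMerge o L u v = S.tableMerge o L v u := by
  rcases u with _ | ⟨i, a⟩ <;> rcases v with _ | ⟨j, b⟩
  · rfl
  · rfl
  · rfl
  · have h := S.mid_comm i j
    simp only [tableMerge, hL i j, h]
    grind

theorem tableMerge_eq_inl {i : {i : R // i ≠ o}} {a : Bool}
    {v w : Option ({i : R // i ≠ o} × Bool)} (h : S.tableMerge o L (some (i, a)) v = Sum.inl w) :
    ∃ k c, w = some (k, c) ∧ c = (a ^^ S.sgn i k) ∧ k ≠ i ∧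
      ((v = none ∧ (k : R) = S.mid i o) ∨
        ∃ j b, v = some (j, b) ∧ (k : R) = S.mid i j ∧ c = (b ^^ S.sgn j k)) := by
  rcases v with _ | ⟨j, b⟩
  · simp only [tableMerge, Sum.inl.injEq] at h
    refine ⟨_, _, h.symm, rfl, fun hk => ?_, Or.inl ⟨rfl, rfl⟩⟩
    exact i.2 (S.eq_of_mid_eq_left (congrArg Subtype.val hk))
  · simp only [tableMerge] at h
    split_ifs at h with h1 h2 h3 h4
    refine ⟨_, _, (Sum.inl_injective h).symm, rfl, fun hk => ?_, Or.inr ⟨j, b, rfl, rfl, h4⟩⟩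
    exact h1 (Subtype.ext (S.eq_of_mid_eq_left (congrArg Subtype.val hk)))

theorem tableMerge_eq_inr_none {i : {i : R // i ≠ o}} {a : Bool}
    {v : Option ({i : R // i ≠ o} × Bool)} (h : S.tableMerge o L (some (i, a)) v = Sum.inr none) :
    ∃ j, v = some (j, a) ∧ S.mid i j = o := by
  rcases v with _ | ⟨j, b⟩ <;> simp only [tableMerge] at h <;> grind

theorem tableMerge_eq_inr_some {i d : {i : R // i ≠ o}} {a : Bool}
    {v : Option ({i : R // i ≠ o} × Bool)} (hv : some (i, a) ≠ v)
    (h : S.tableMerge o L (some (i, a)) v = Sum.inr (some d)) :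
    ∃ j b, v = some (j, b) ∧ d = L i j ∧
      ((i = j ∨ S.mid i j = o) ∧ b = !a ∨ i ≠ j ∧ S.mid i j ≠ o ∧
        b = (!a ^^ S.sgn i (S.mid i j) ^^ S.sgn j (S.mid i j))) := by
  rcases v with _ | ⟨j, b⟩
  · simp only [tableMerge, reduceCtorEq] at h
  · have hne : i = j → b = !a := by
      rintro rfl
      cases a <;> cases b <;> simp at hv ⊢
    refine ⟨j, b, rfl, ?_⟩
    simp only [tableMerge] at h
    split_ifs at h with h1 h2 h3 h3
    · exact ⟨by simpa [← h1, eq_comm] using h, Or.inl ⟨Or.inl h1, hne h1⟩⟩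
    · simp at h
    · exact ⟨by simpa [eq_comm] using h, Or.inl ⟨Or.inr h2, Bool.eq_not_of_ne (Ne.symm h3)⟩⟩
    · refine ⟨by simpa [eq_comm] using h, Or.inr ⟨h1, h2, ?_⟩⟩
      revert h3
      generalize S.sgn i _ = x
      generalize S.sgn j _ = y
      clear h hne hv
      revert a b x y
      decide

theorem tableMerge_proper (hL : ∀ i j k, L i j = L i k → j = k)
    {u v w : Option ({i : R // i ≠ o} × Bool)} (hv : u ≠ v) (hw : u ≠ w)
    (h : S.tableMerge o L u v = S.tableMerge o L u w) : v = w := by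
  rcases u with _ | ⟨i, a⟩
  · rcases v with _ | ⟨j, b⟩
    · exact absurd rfl hv
    · rcases w with _ | ⟨k, c⟩
      · exact absurd rfl hw
      · simp only [tableMerge, Sum.inl.injEq, Option.some.injEq, Prod.mk.injEq] at h
        obtain ⟨h1, h2⟩ := h
        have h3 : S.mid o j = S.mid o k := by
          rw [S.mid_comm o, S.mid_comm o]
          exact congrArg Subtype.val h1
        obtain rfl : j = k := Subtype.ext (S.mid_cancel _ _ _ h3)
        rw [Bool.xor_left_inj.1 h2]
  · rcases hc : S.tableMerge o L (some (i, a)) w with c | _ | d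
    · rw [hc] at h
      obtain ⟨k, e, rfl, he, -, h1⟩ := S.tableMerge_eq_inl h
      obtain ⟨k', e', hk, he', -, h2⟩ := S.tableMerge_eq_inl hc
      simp only [Option.some.injEq, Prod.mk.injEq] at hk
      obtain ⟨rfl, rfl⟩ := hk
      rcases h1 with ⟨rfl, h1⟩ | ⟨j, b, rfl, h1, hb⟩ <;>
        rcases h2 with ⟨rfl, h2⟩ | ⟨j', b', rfl, h2, hb'⟩
      · rfl
      · exact absurd (S.mid_cancel _ _ _ (h1.symm.trans h2)).symm j'.2
      · exact absurd (S.mid_cancel _ _ _ (h1.symm.trans h2)) j.2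
      · obtain rfl : j = j' := Subtype.ext (S.mid_cancel _ _ _ (h1.symm.trans h2))
        rw [Bool.xor_left_inj.1 (hb.symm.trans hb')]
    · rw [hc] at h
      obtain ⟨j, rfl, hj⟩ := S.tableMerge_eq_inr_none h
      obtain ⟨k, rfl, hk⟩ := S.tableMerge_eq_inr_none hc
      rw [Subtype.ext (S.mid_cancel _ _ _ (hj.trans hk.symm))]
    · rw [hc] at h
      obtain ⟨j, b, rfl, rfl, hb⟩ := S.tableMerge_eq_inr_some hv h
      obtain ⟨k, c, rfl, hd, hc⟩ := S.tableMerge_eq_inr_some hw hc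
      obtain rfl := hL _ _ _ hd
      grind

theorem tableMerge_harm {u u' w w' : Option ({i : R // i ≠ o} × Bool)}
    (h : S.tableMerge o L u u' = Sum.inl w) : S.tableMerge o L w w' ≠ Sum.inl u := by
  intro h'
  have hnone : ∀ {x y z}, S.tableMerge o L x y = Sum.inl z → z ≠ none := by
    -- No edge carries the colour of the merged point.
    rintro (_ | ⟨i, a⟩) (_ | ⟨j, b⟩) z h rfl <;> simp only [tableMerge] at h <;> grind
  rcases u with _ | ⟨i, a⟩
  · exact hnone h' rfl
  · rcases w with _ | ⟨k, c⟩
    · exact hnone h rfl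
    · obtain ⟨k', c', h1, h2, h3, -⟩ := S.tableMerge_eq_inl h
      obtain ⟨i', a', h1', h2', -, -⟩ := S.tableMerge_eq_inl h'
      simp only [Option.some.injEq, Prod.mk.injEq] at h1 h1'
      obtain ⟨rfl, rfl⟩ := h1
      obtain ⟨rfl, rfl⟩ := h1'
      have := S.sgn_ne i k fun h => h3 (Subtype.ext h.symm)
      revert h2 h2' this
      generalize S.sgn i k = x
      generalize S.sgn k i = y
      cases a <;> cases c <;> cases x <;> cases y <;> simp

/-- Each `(i, a)` keeps towards the merged point the one vertex colour it used towards the two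
copies of `o`. Pairs with midpoint `o` lose their vertex colours: equal bits get the extra colour
`none`. All other edges without a vertex colour are coloured by a commutative Latin square on the
points other than `o`, because for given `(i, a)` and `j` exactly one bit remains. -/
theorem nonempty_colouring_merge [Fintype R] (S : MidpointSystem R) {m n k : ℕ} [NeZero m]
    (hm : Fintype.card R = m + 1) (hn : 2 * m + 1 = n) (hk : 3 * m + 2 = k) :
    Nonempty (HarmoniousTotalColouring (SimpleGraph.completeGraph (Fin n)) (Fin k)) := by
  have : Nonempty R := Fintype.card_pos_iff.1 (by omega)
  obtain ⟨o⟩ := this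
  have hJ : Fintype.card {i : R // i ≠ o} = m := by
    rw [Fintype.card_subtype_compl, Fintype.card_subtype_eq, hm, Nat.add_sub_cancel]
  -- The Latin square need not be idempotent, so the addition table of `ZMod m` serves for every
  -- `m`.
  obtain ⟨e⟩ : Nonempty ({i : R // i ≠ o} ≃ ZMod m) :=
    Fintype.card_eq.1 (by rw [hJ, ZMod.card])
  refine nonempty_colouring_of_table (V := Option ({i : R // i ≠ o} × Bool))
    (X := Option {i : R // i ≠ o}) ?_ ?_ (S.tableMerge o fun i j => e.symm (e i + e j)) ?_ ?_ ?_ ?_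
  · simp only [Fintype.card_option, Fintype.card_prod, Fintype.card_bool, hJ]
    omega
  · simp only [Fintype.card_option, Fintype.card_prod, Fintype.card_bool, hJ]
    omega
  · exact S.tableMerge_comm fun i j => by rw [add_comm]
  · rintro (_ | ⟨i, a⟩) v huv h
    · rcases v with _ | ⟨j, b⟩
      · exact huv rfl
      · simp [tableMerge] at h
    · obtain ⟨k, c, h1, -, h2, -⟩ := S.tableMerge_eq_inl h
      simp only [Option.some.injEq, Prod.mk.injEq] at h1
      exact h2 h1.1.symm
  · refine fun u v w => S.tableMerge_proper fun i j k h => ?_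
    exact e.injective (add_left_cancel (e.symm.injective h))
  · exact fun u u' w w' _ _ h => S.tableMerge_harm h

end MidpointSystem

/-! ### Orders 4, 8 and 12: explicit tables. -/

theorem nonempty_colouring_of_fin_table {n x : ℕ} (T : Fin n → Fin n → Fin (n + x))
    (symm : ∀ u v, T u v = T v u) (incident : ∀ u v, u ≠ v → T u v ≠ Fin.castAdd x u)
    (proper : ∀ u v w, u ≠ v → u ≠ w → T u v = T u w → v = w)
    (harm : ∀ u u' w, u ≠ u' → T u u' = Fin.castAdd x w →
      ∀ w', w ≠ w' → T w w' ≠ Fin.castAdd x u) :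
    Nonempty (HarmoniousTotalColouring (SimpleGraph.completeGraph (Fin n)) (Fin (n + x))) := by
  have hT : ∀ {u v w : Fin n}, finSumFinEquiv.symm (T u v) = Sum.inl w → T u v = Fin.castAdd x w :=
    fun h => by rw [Equiv.symm_apply_eq] at h; exact h
  refine nonempty_colouring_of_table (V := Fin n) (X := Fin x) (by simp) (by simp)
    (fun u v => finSumFinEquiv.symm (T u v)) ?_ ?_ ?_ ?_
  · exact fun u v => by rw [symm]
  · exact fun u v huv h => incident u v huv (hT h)
  · exact fun u v w hv hw h => proper u v w hv hw (finSumFinEquiv.symm.injective h)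
  · exact fun u u' w w' hu hw h h' => harm u u' w hu (hT h) w' hw (hT h')

theorem nonempty_colouring_four :
    Nonempty (HarmoniousTotalColouring (SimpleGraph.completeGraph (Fin 4)) (Fin 7)) := by
  -- A proper edge colouring by three extra colours, so harmony is vacuous. Diagonal entries are
  -- placeholders here and below.
  refine nonempty_colouring_of_fin_table (n := 4) (x := 3)
    ![![0, 4, 5, 6], ![4, 0, 6, 5], ![5, 6, 0, 4], ![6, 5, 4, 0]] ?_ ?_ ?_ ?_ <;> decide +kernel

theorem nonempty_colouring_eight :
    Nonempty (HarmoniousTotalColouring (SimpleGraph.completeGraph (Fin 8)) (Fin 12)) := by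
  -- Entries below 8 are vertex colours, the others extra; off the diagonal, 0 is the colour of
  -- vertex 0.
  refine nonempty_colouring_of_fin_table (n := 8) (x := 4)
    ![![0, 9, 3, 7, 5, 10, 8, 2], ![9, 0, 10, 8, 11, 3, 4, 6], ![3, 10, 0, 6, 8, 1, 11, 9],
      ![7, 8, 6, 0, 9, 11, 10, 4], ![5, 11, 8, 9, 0, 2, 0, 10], ![10, 3, 1, 11, 2, 0, 9, 8],
      ![8, 4, 11, 10, 0, 9, 0, 5], ![2, 6, 9, 4, 10, 8, 5, 0]] ?_ ?_ ?_ ?_ <;> decide +kernel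

theorem nonempty_colouring_twelve :
    Nonempty (HarmoniousTotalColouring (SimpleGraph.completeGraph (Fin 12)) (Fin 18)) := by
  refine nonempty_colouring_of_fin_table (n := 12) (x := 6)
    ![![0, 11, 10, 15, 14, 4, 13, 8, 16, 6, 17, 12], ![11, 0, 9, 5, 16, 12, 17, 14, 6, 13, 7, 15],
      ![10, 9, 0, 13, 3, 17, 7, 15, 12, 16, 14, 8], ![15, 5, 13, 0, 1, 0, 14, 16, 10, 17, 12, 7],
      ![14, 16, 3, 1, 0, 2, 11, 12, 17, 8, 15, 13], ![4, 12, 17, 0, 2, 0, 15, 9, 13, 14, 6, 16],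
      ![13, 17, 7, 14, 11, 15, 0, 4, 3, 12, 16, 2], ![8, 14, 15, 16, 12, 9, 4, 0, 5, 0, 13, 17],
      ![16, 6, 12, 10, 17, 13, 3, 5, 0, 15, 1, 14], ![6, 13, 16, 17, 8, 14, 12, 0, 15, 0, 4, 3],
      ![17, 7, 14, 12, 15, 6, 16, 13, 1, 4, 0, 5], ![12, 15, 8, 7, 13, 16, 2, 17, 14, 3, 5, 0]]
    ?_ ?_ ?_ ?_ <;> decide +kernel

/-! ### The lower bound. -/

namespace HarmoniousTotalColouring

variable {n k : ℕ} (c : HarmoniousTotalColouring (SimpleGraph.completeGraph (Fin n)) (Fin k))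

theorem vertexColour_injective : Function.Injective c.vertexColour := by
  intro u v h
  by_contra hne
  exact c.vertex_proper u v hne h

/-- The colour of the edge joining two vertices. -/
def colour (u v : Fin n) : Fin k :=
  if h : u ≠ v then c.edgeColour ⟨s(u, v), h⟩ else c.vertexColour u

theorem colour_of_ne {u v : Fin n} (h : u ≠ v) : c.colour u v = c.edgeColour ⟨s(u, v), h⟩ :=
  dif_pos h

theorem colour_comm (u v : Fin n) : c.colour u v = c.colour v u := by
  by_cases h : u = v
  · rw [h]
  · rw [c.colour_of_ne h, c.colour_of_ne (Ne.symm h)]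
    congr 2
    exact Sym2.eq_swap

theorem colour_proper {u v w : Fin n} (hv : u ≠ v) (hw : u ≠ w) (h : c.colour u v = c.colour u w) :
    v = w := by
  rw [c.colour_of_ne hv, c.colour_of_ne hw] at h
  by_contra hne
  refine c.edge_proper _ _ (fun he => hne ?_) u (by simp) (by simp) h
  exact Sym2.congr_right.1 (congrArg Subtype.val he)

theorem colour_ne_left {u v : Fin n} (h : u ≠ v) : c.colour u v ≠ c.vertexColour u := by
  rw [c.colour_of_ne h]
  exact (c.incident_proper u _ (by simp)).symm

theorem colour_ne_right {u v : Fin n} (h : u ≠ v) : c.colour u v ≠ c.vertexColour v := by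
  rw [c.colour_comm]
  exact c.colour_ne_left h.symm

theorem colour_harm {u u' w w' : Fin n} (hu : u ≠ u') (hw : w ≠ w')
    (h : c.colour u u' = c.vertexColour w) : c.colour w w' ≠ c.vertexColour u := by
  intro h'
  have hne := c.colour_ne_left hu
  rw [h] at hne
  rw [c.colour_of_ne hu] at h
  rw [c.colour_of_ne hw] at h'
  have := (c.harmonious u w _ _ (by simp) (by simp) (Sym2.eq_iff.2 (Or.inr ⟨h'.symm, h⟩))).1
  exact hne (by rw [this])

theorem card_colour_eq_le (x : Fin k) :
    {p ∈ (Finset.univ : Finset (Fin n)).offDiag | c.colour p.1 p.2 = x}.card ≤ 2 * (n / 2) := by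
  set F := {p ∈ (Finset.univ : Finset (Fin n)).offDiag | c.colour p.1 p.2 = x} with hF
  have hmem : ∀ p, p ∈ F ↔ p.1 ≠ p.2 ∧ c.colour p.1 p.2 = x := by simp [hF]
  have h1 : F.card ≤ n := by
    have : F.card ≤ (Finset.univ : Finset (Fin n)).card := by
      refine Finset.card_le_card_of_injOn Prod.fst (fun _ _ => Finset.mem_univ _) ?_
      rintro ⟨u, v⟩ h ⟨u', v'⟩ h' (rfl : u = u')
      rw [Finset.mem_coe, hmem] at h h'
      exact congrArg (Prod.mk u) (c.colour_proper h.1 h'.1 (h.2.trans h'.2.symm))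
    simpa using this
  have h2 : Even F.card := by
    -- Swapping the two ends is a fixed-point-free involution, so the number of ordered pairs is
    -- even.
    rw [← ZMod.natCast_eq_zero_iff_even, ← nsmul_one, ← Finset.sum_const]
    refine Finset.sum_involution (fun p _ => p.swap) (fun _ _ => by decide) ?_ ?_ ?_
    · rintro ⟨u, v⟩ h - h'
      exact ((hmem _).1 h).1 (Prod.ext_iff.1 h').2
    · rintro ⟨u, v⟩ h
      rw [hmem] at h ⊢
      exact ⟨h.1.symm, (c.colour_comm v u).trans h.2⟩
    · exact fun p _ => p.swap_swap
  obtain ⟨r, hr⟩ := h2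
  omega

/-- In the directed graph with an arc from `u` to `w` whenever some edge at `u` has the colour of
`w`, harmony forbids opposite arcs. Properness makes the arcs at `u` correspond to the edges at `u`
with vertex colours. -/
theorem two_mul_card_vertex_coloured_le :
    2 * {p ∈ (Finset.univ : Finset (Fin n)).offDiag |
      ∃ w, c.vertexColour w = c.colour p.1 p.2}.card ≤ n * n - n := by
  set F := {p ∈ (Finset.univ : Finset (Fin n)).offDiag | ∃ w, c.vertexColour w = c.colour p.1 p.2}
    with hF
  have hmem : ∀ p, p ∈ F ↔ p.1 ≠ p.2 ∧ ∃ w, c.vertexColour w = c.colour p.1 p.2 := by simp [hF]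
  set G := {q ∈ (Finset.univ : Finset (Fin n)).offDiag |
    ∃ v, q.1 ≠ v ∧ c.vertexColour q.2 = c.colour q.1 v} with hG
  have hmemG : ∀ q, q ∈ G ↔ q.1 ≠ q.2 ∧ ∃ v, q.1 ≠ v ∧ c.vertexColour q.2 = c.colour q.1 v := by
    simp [hG]
  have h1 : F.card ≤ G.card := by
    have hex : ∀ p : Fin n × Fin n, ∃ w, p ∈ F → c.vertexColour w = c.colour p.1 p.2 := by
      intro p
      by_cases hp : p ∈ F
      · obtain ⟨w, hw⟩ := ((hmem p).1 hp).2
        exact ⟨w, fun _ => hw⟩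
      · exact ⟨p.1, fun h => absurd h hp⟩
    choose f hf using hex
    refine Finset.card_le_card_of_injOn (fun p => (p.1, f p)) ?_ ?_
    · rintro ⟨u, v⟩ h
      have h' := ((hmem _).1 h).1
      have hc := hf _ h
      refine (hmemG _).2 ⟨fun he => c.colour_ne_left h' ?_, v, h', hc⟩
      change u = f (u, v) at he
      rw [he]
      exact he ▸ hc.symm
    · rintro ⟨u, v⟩ h ⟨u', v'⟩ h' he
      obtain ⟨rfl, h2⟩ : u = u' ∧ f (u, v) = f (u', v') := Prod.ext_iff.1 he
      have hc := hf _ h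
      rw [h2, hf _ h'] at hc
      exact congrArg (Prod.mk u) (c.colour_proper ((hmem _).1 h).1 ((hmem _).1 h').1 hc.symm)
  have h2 : Disjoint G (G.map (Equiv.prodComm _ _).toEmbedding) := by
    rw [Finset.disjoint_left]
    rintro ⟨u, w⟩ h h'
    rw [Finset.mem_map_equiv] at h'
    obtain ⟨-, v, hv, hc⟩ := (hmemG _).1 h
    obtain ⟨-, v', hv', hc'⟩ := (hmemG _).1 h'
    exact c.colour_harm hv hv' hc.symm hc'.symm
  have h3 : (G.disjUnion _ h2).card ≤ ((Finset.univ : Finset (Fin n)).offDiag).card := by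
    refine Finset.card_le_card fun q hq => ?_
    rcases Finset.mem_disjUnion.1 hq with hq | hq
    · exact Finset.mem_of_mem_filter _ hq
    · rw [Finset.mem_map_equiv, hmemG] at hq
      simpa using hq.1.symm
  rw [Finset.card_disjUnion, Finset.card_map, Finset.offDiag_card, Finset.card_univ,
    Fintype.card_fin] at h3
  omega

/-- The colours that are not vertex colours. -/
def extra : Finset (Fin k) := (Finset.univ.map ⟨_, c.vertexColour_injective⟩)ᶜ

theorem mem_extra {x : Fin k} : x ∈ c.extra ↔ ∀ w, c.vertexColour w ≠ x := by
  simp [extra]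

theorem card_extra : c.extra.card = k - n := by
  simp [extra, Finset.card_compl]

theorem card_le (c : HarmoniousTotalColouring (SimpleGraph.completeGraph (Fin n)) (Fin k)) : n ≤ k := by
  simpa using Fintype.card_le_of_injective _ c.vertexColour_injective

theorem three_mul_le (c : HarmoniousTotalColouring (SimpleGraph.completeGraph (Fin n)) (Fin k))
    (hn : 2 ≤ n) : (3 * n + 1) / 2 ≤ k := by
  have h1 := c.two_mul_card_vertex_coloured_le
  have h2 : {p ∈ (Finset.univ : Finset (Fin n)).offDiag |
      ¬ ∃ w, c.vertexColour w = c.colour p.1 p.2}.card ≤ 2 * (n / 2) * (k - n) := by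
    rw [← c.card_extra]
    refine Finset.card_le_mul_card_image_of_maps_to (f := fun p => c.colour p.1 p.2) ?_ _ ?_
    · intro p hp
      rw [c.mem_extra]
      simpa using (Finset.mem_filter.1 hp).2
    · intro x _
      refine le_trans (Finset.card_le_card ?_) (c.card_colour_eq_le x)
      intro p hp
      simp only [Finset.mem_filter] at hp ⊢
      exact ⟨hp.1.1, hp.2⟩
  have h3 := Finset.card_filter_add_card_filter_not (s := (Finset.univ : Finset (Fin n)).offDiag)
    (fun p => ∃ w, c.vertexColour w = c.colour p.1 p.2)
  rw [Finset.offDiag_card, Finset.card_univ, Fintype.card_fin] at h3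
  obtain ⟨e, rfl⟩ := Nat.exists_eq_add_of_le c.card_le
  obtain ⟨m, rfl⟩ := Nat.exists_eq_add_of_le hn
  rw [Nat.add_sub_cancel_left] at h2
  have h4 : (2 + m) * (2 + m) - (2 + m) = (2 + m) * (1 + m) := by
    rw [Nat.sub_eq_iff_eq_add (Nat.le_mul_self _)]
    ring
  rw [h4] at h1 h3
  have h5 : (2 + m) * (1 + m) ≤ 2 * (2 * ((2 + m) / 2) * e) := by omega
  obtain ⟨r, rfl | rfl⟩ := Nat.even_or_odd' m
  · rw [show (2 + 2 * r) / 2 = 1 + r by omega] at h5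
    have : 1 + 2 * r ≤ 2 * e := by
      by_contra! h
      nlinarith
    omega
  · rw [show (2 + (2 * r + 1)) / 2 = 1 + r by omega] at h5
    have : 3 + 2 * r ≤ 2 * e := by
      by_contra! h
      nlinarith
    omega

end HarmoniousTotalColouring

/-- With two extra colours, every star and every triangle contains an edge with a vertex colour,
since its three edges pairwise meet. Two disjoint edges cannot both have vertex colours: each would
be coloured by an end of the other. So the edges with vertex colours pairwise meet and lie in a star
or a triangle, but the complement of a star is a triangle and vice versa. -/
theorem six_lt_of_colouring_four {k : ℕ}
    (c : HarmoniousTotalColouring (SimpleGraph.completeGraph (Fin 4)) (Fin k)) : 6 < k := by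
  by_contra! hk
  have hextra : c.extra.card ≤ 2 := by
    rw [c.card_extra]
    omega
  have hthree : ∀ x y z, x ∈ c.extra → y ∈ c.extra → z ∈ c.extra → x ≠ y → x ≠ z → y ≠ z → False := by
    intro x y z hx hy hz hxy hxz hyz
    have : ({x, y, z} : Finset (Fin k)) ⊆ c.extra := by
      simp [Finset.insert_subset_iff, hx, hy, hz]
    have := Finset.card_le_card this
    rw [Finset.card_eq_three.2 ⟨x, y, z, hxy, hxz, hyz, rfl⟩] at this
    omega
  classical
  obtain ⟨P, hP⟩ : ∃ P : Fin 4 → Fin 4 → Bool, ∀ u v, P u v = true ↔ c.colour u v ∉ c.extra :=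
    ⟨fun u v => decide (c.colour u v ∉ c.extra), by simp⟩
  have hsymm : ∀ u v, P u v = P v u := fun u v => by
    rw [Bool.eq_iff_iff, hP, hP, c.colour_comm]
  have hstar : ∀ u v w z, u ≠ v → u ≠ w → u ≠ z → v ≠ w → v ≠ z → w ≠ z →
      (P u v || P u w || P u z) = true := by
    intro u v w z h1 h2 h3 h4 h5 h6
    by_contra h
    simp only [Bool.or_eq_true, hP, not_or, not_not] at h
    exact hthree _ _ _ h.1.1 h.1.2 h.2 (fun h => h4 (c.colour_proper h1 h2 h))
      (fun h => h5 (c.colour_proper h1 h3 h)) (fun h => h6 (c.colour_proper h2 h3 h))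
  have htri : ∀ u v w, u ≠ v → u ≠ w → v ≠ w → (P u v || P u w || P v w) = true := by
    intro u v w h1 h2 h3
    by_contra h
    simp only [Bool.or_eq_true, hP, not_or, not_not] at h
    refine hthree _ _ _ h.1.1 h.1.2 h.2 (fun h => h3 (c.colour_proper h1 h2 h)) (fun h => ?_)
      (fun h => ?_)
    · exact h2 (c.colour_proper h1.symm h3 (by rw [c.colour_comm, h]))
    · exact h1 (c.colour_proper h2.symm h3.symm (by rw [c.colour_comm, h, c.colour_comm]))
  have hdisj : ∀ u v w z, u ≠ v → u ≠ w → u ≠ z → v ≠ w → v ≠ z → w ≠ z →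
      (P u v && P w z) = false := by
    intro u v w z h1 h2 h3 h4 h5 h6
    by_contra h
    simp only [Bool.not_eq_false, Bool.and_eq_true, hP, c.mem_extra, not_forall, not_not] at h
    obtain ⟨⟨a, ha⟩, b, hb⟩ := h
    have ha' : a = w ∨ a = z := by
      have hu : a ≠ u := fun h => c.colour_ne_left h1 (by rw [← ha, h])
      have hv : a ≠ v := fun h => c.colour_ne_right h1 (by rw [← ha, h])
      omega
    have hb' : b = u ∨ b = v := by
      have hw : b ≠ w := fun h => c.colour_ne_left h6 (by rw [← hb, h])
      have hz : b ≠ z := fun h => c.colour_ne_right h6 (by rw [← hb, h])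
      omega
    rcases ha' with rfl | rfl <;> rcases hb' with rfl | rfl
    · exact c.colour_harm h1 h6 ha.symm hb.symm
    · exact c.colour_harm h1.symm h6 (by rw [c.colour_comm, ha]) hb.symm
    · exact c.colour_harm h1 h6.symm ha.symm (by rw [c.colour_comm, hb])
    · exact c.colour_harm h1.symm h6.symm (by rw [c.colour_comm, ha]) (by rw [c.colour_comm, hb])
  have s0 := hstar 0 1 2 3 (by decide) (by decide) (by decide) (by decide) (by decide) (by decide)
  have s1 := hstar 1 0 2 3 (by decide) (by decide) (by decide) (by decide) (by decide) (by decide)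
  have s2 := hstar 2 0 1 3 (by decide) (by decide) (by decide) (by decide) (by decide) (by decide)
  have s3 := hstar 3 0 1 2 (by decide) (by decide) (by decide) (by decide) (by decide) (by decide)
  have t0 := htri 1 2 3 (by decide) (by decide) (by decide)
  have t1 := htri 0 2 3 (by decide) (by decide) (by decide)
  have t2 := htri 0 1 3 (by decide) (by decide) (by decide)
  have t3 := htri 0 1 2 (by decide) (by decide) (by decide)
  have d1 := hdisj 0 1 2 3 (by decide) (by decide) (by decide) (by decide) (by decide) (by decide)
  have d2 := hdisj 0 2 1 3 (by decide) (by decide) (by decide) (by decide) (by decide) (by decide)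
  have d3 := hdisj 0 3 1 2 (by decide) (by decide) (by decide) (by decide) (by decide) (by decide)
  rw [hsymm 1 0] at s1
  rw [hsymm 2 0, hsymm 2 1] at s2
  rw [hsymm 3 0, hsymm 3 1, hsymm 3 2] at s3
  revert s0 s1 s2 s3 t0 t1 t2 t3 d1 d2 d3
  generalize P 0 1 = p01
  generalize P 0 2 = p02
  generalize P 0 3 = p03
  generalize P 1 2 = p12
  generalize P 1 3 = p13
  generalize P 2 3 = p23
  clear hP hsymm hstar htri hdisj hthree hextra hk
  revert p01 p02 p03 p12 p13 p23
  decide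

/-! ### Complete graphs whose order is a multiple of four -/

namespace CyclicTable

variable {t : ℕ}

theorem intCast_inj {a b : ℤ} (h : (a : ZMod (2 * t)) = b) (h1 : a - b < 2 * t)
    (h2 : b - a < 2 * t) : a = b := by
  rw [ZMod.intCast_eq_intCast_iff_dvd_sub] at h
  have := Int.eq_zero_of_abs_lt_dvd h (by rw [abs_lt]; push_cast; constructor <;> linarith)
  linarith

theorem half_add_half : (t : ZMod (2 * t)) + t = 0 := by
  have : ((2 * t : ℕ) : ZMod (2 * t)) = 0 := ZMod.natCast_self _
  push_cast at this
  linear_combination this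

/-- The signed displacement between two residues. -/
def disp (x y : ZMod (2 * t)) : ℤ := (y - x).valMinAbs

theorem cast_disp (x y : ZMod (2 * t)) : ((disp x y : ℤ) : ZMod (2 * t)) = y - x :=
  ZMod.coe_valMinAbs _

theorem disp_bounds [NeZero t] (x y : ZMod (2 * t)) : -t < disp x y ∧ disp x y ≤ t := by
  have := ZMod.valMinAbs_mem_Ioc (y - x)
  rw [Set.mem_Ioc] at this
  push_cast at this
  unfold disp
  omega

theorem disp_eq_zero {x y : ZMod (2 * t)} : disp x y = 0 ↔ x = y := by
  rw [disp, ZMod.valMinAbs_eq_zero, sub_eq_zero, eq_comm]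

theorem eq_of_disp_eq {x y y' : ZMod (2 * t)} (h : disp x y = disp x y') : y = y' := by
  have := cast_disp x y
  rw [h, cast_disp] at this
  exact (sub_left_injective this).symm

theorem disp_eq_half_iff [NeZero t] {x y : ZMod (2 * t)} : disp x y = t ↔ y = x + t := by
  have h1 := cast_disp x y
  have h2 := disp_bounds x y
  constructor
  · intro h
    rw [h] at h1
    push_cast at h1
    linear_combination -h1
  · rintro rfl
    refine intCast_inj (t := t) ?_ (by omega) (by omega)
    rw [h1]
    push_cast
    ring

theorem disp_swap [NeZero t] {x y : ZMod (2 * t)} (h : disp x y ≠ t) : disp y x = -disp x y := by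
  have h1 := disp_bounds x y
  have h2 := disp_bounds y x
  have h3 : disp y x ≠ t := fun h' => h (disp_eq_half_iff.2 (by
    rw [disp_eq_half_iff.1 h']
    linear_combination -half_add_half (t := t)))
  refine intCast_inj (t := t) ?_ (by omega) (by omega)
  push_cast
  rw [cast_disp, cast_disp]
  ring

/-- How far the apex of a pair lies behind its first end. -/
def offset (t : ℕ) (d : ℤ) : ℤ := (t + 1 - d) / 2

/-- The apex of a pair of residues that are not opposite. -/
def apex (x y : ZMod (2 * t)) : ZMod (2 * t) := x - (offset t (disp x y) : ℤ)

theorem apex_comm [NeZero t] {x y : ZMod (2 * t)} (h : disp x y ≠ t) : apex x y = apex y x := by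
  have h1 : offset t (-disp x y) = offset t (disp x y) + disp x y := by
    unfold offset
    omega
  rw [apex, apex, disp_swap h, h1]
  push_cast
  rw [cast_disp]
  ring

/-- The sign of the first end of a pair of residues. -/
def sgn (x y : ZMod (2 * t)) : Bool :=
  -- Distinct displacements with the same offset have opposite parity, so parity separates them.
  -- Only `1 - t` has offset `t`; there `x` and the apex are antipodal, and the sign is free to
  -- break the tie between them.
  if disp x y = 1 - t then decide ((apex x y).val < t) else decide (disp x y % 2 = 1)

theorem sgn_comm [NeZero t] {x y : ZMod (2 * t)} (h : disp x y ≠ t) (h1 : disp x y ≠ t - 1)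
    (h2 : disp x y ≠ 1 - t) : sgn x y = sgn y x := by
  rw [sgn, sgn, disp_swap h, if_neg h2, if_neg (by omega), decide_eq_decide]
  omega

theorem val_lt_add_half [NeZero t] (x : ZMod (2 * t)) : (x + t).val < t ↔ ¬ x.val < t := by
  have h1 := ZMod.val_lt x
  have h2 : t < 2 * t := by have := NeZero.pos t; omega
  rw [ZMod.val_add, ZMod.val_cast_of_lt h2]
  by_cases h : x.val < t
  · rw [Nat.mod_eq_of_lt (by omega)]
    omega
  · rw [Nat.mod_eq_sub_mod (by omega), Nat.mod_eq_of_lt (by omega)]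
    omega

/-- The residue of `x` modulo `t`. -/
def res (x : ZMod (2 * t)) : ℕ := x.val % t

theorem res_lt [NeZero t] (x : ZMod (2 * t)) : res x < t := Nat.mod_lt _ (NeZero.pos t)

theorem res_add_half [NeZero t] (x : ZMod (2 * t)) : res (x + (t : ZMod (2 * t))) = res x := by
  rw [res, res, ZMod.val_add, Nat.mod_mod_of_dvd _ (Dvd.intro_left 2 rfl), Nat.add_mod,
    ZMod.val_natCast, Nat.mod_mod_of_dvd _ (Dvd.intro_left 2 rfl), Nat.mod_self, add_zero,
    Nat.mod_mod]

theorem res_eq_succ [NeZero t] (x : ZMod (2 * t)) : res x = (res (x - 1) + 1) % t := by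
  have h1 : res x = res (x - 1 + ((1 : ℕ) : ZMod (2 * t))) := by
    congr 1
    push_cast
    ring
  rw [h1, res, res, ZMod.val_add, Nat.mod_mod_of_dvd _ (Dvd.intro_left 2 rfl), Nat.add_mod,
    ZMod.val_natCast, Nat.mod_mod_of_dvd _ (Dvd.intro_left 2 rfl), ← Nat.add_mod, Nat.mod_add_mod]

/-- A proper colouring of the cycle of length `t` with the colours `t - 1`, `t`, `t + 1`. -/
def cyc (t r : ℕ) : ℤ := if r + 1 = t then t + 1 else if r % 2 = 0 then t - 1 else t

theorem cyc_mem (t r : ℕ) : cyc t r = t - 1 ∨ cyc t r = t ∨ cyc t r = t + 1 := by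
  unfold cyc
  split_ifs <;> simp

theorem cyc_res_ne [NeZero t] (ht : 2 ≤ t) (x : ZMod (2 * t)) :
    cyc t (res (x - 1)) ≠ cyc t (res x) := by
  have h1 := res_lt (x - 1)
  rw [res_eq_succ x]
  by_cases h : res (x - 1) + 1 = t
  · rw [h, Nat.mod_self]
    unfold cyc
    split_ifs <;> omega
  · rw [Nat.mod_eq_of_lt (by omega)]
    unfold cyc
    split_ifs <;> omega

/-- The table of colours on two copies of the residues. -/
def table (t : ℕ) (u v : ZMod (2 * t) × Bool) : (ZMod (2 * t) × Bool) ⊕ ZMod (2 * t) :=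
  if u.1 = v.1 then Sum.inr ((0 : ℤ) : ZMod (2 * t))
  else if disp u.1 v.1 = t then
    if u.2 = v.2 then Sum.inr (((t + 1) / 2 : ℤ) : ZMod (2 * t))
    else Sum.inr ((3 * t - cyc t (res (u.1 - 1)) - cyc t (res u.1) : ℤ) : ZMod (2 * t))
  else if (u.2 ^^ sgn u.1 v.1) = (v.2 ^^ sgn v.1 u.1) then
    Sum.inl (apex u.1 v.1, u.2 ^^ sgn u.1 v.1)
  else if disp u.1 v.1 = t - 1 then Sum.inr ((cyc t (res (u.1 - 1)) : ℤ) : ZMod (2 * t))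
  else if disp u.1 v.1 = 1 - t then Sum.inr ((cyc t (res u.1) : ℤ) : ZMod (2 * t))
  -- The other extra colours are differences, end with bit `true` minus end with bit `false`. The
  -- difference `(t + 1) / 2` is diverted to a vertex colour, so that antipodal points with equal
  -- bits can use it.
  else if (if u.2 then u.1 - v.1 else v.1 - u.1) = (((t + 1) / 2 : ℤ) : ZMod (2 * t)) then
    Sum.inl (if u.2 then v.1 else u.1, true)
  else Sum.inr (if u.2 then u.1 - v.1 else v.1 - u.1)

theorem table_comm [NeZero t] (u v : ZMod (2 * t) × Bool) : table t u v = table t v u := by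
  obtain ⟨x, a⟩ := u
  obtain ⟨y, b⟩ := v
  unfold table
  simp only
  by_cases h0 : x = y
  · simp only [h0, if_true]
  rw [if_neg h0, if_neg (Ne.symm h0)]
  by_cases h1 : disp x y = t
  · obtain rfl := disp_eq_half_iff.1 h1
    have h2 : disp (x + (t : ZMod (2 * t))) x = t := disp_eq_half_iff.2 (by
      linear_combination -half_add_half (t := t))
    rw [if_pos h1, if_pos h2, res_add_half, show x + (t : ZMod (2 * t)) - 1 = x - 1 + t by ring,
      res_add_half, if_congr eq_comm rfl rfl]
  have h2 : disp y x ≠ t := by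
    rw [disp_swap h1]
    have := disp_bounds x y
    omega
  rw [if_neg h1, if_neg h2]
  by_cases h3 : (a ^^ sgn x y) = (b ^^ sgn y x)
  · rw [if_pos h3, if_pos h3.symm, apex_comm h1, h3]
  rw [if_neg h3, if_neg (Ne.symm h3), disp_swap h1]
  have hy := cast_disp x y
  by_cases h4 : disp x y = t - 1
  · have ht : (t : ℤ) ≠ 1 := by
      intro ht
      exact h0 (disp_eq_zero.1 (by omega))
    rw [if_pos h4, if_neg (by omega), if_pos (by omega), ← res_add_half (x - 1)]
    rw [h4] at hy
    push_cast at hy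
    rw [show x - 1 + t = y by linear_combination hy]
  by_cases h5 : disp x y = 1 - t
  · rw [if_neg h4, if_pos h5, if_pos (by omega), ← res_add_half x]
    rw [h5] at hy
    push_cast at hy
    rw [show x + (t : ZMod (2 * t)) = y - 1 by
      linear_combination hy + half_add_half (t := t)]
  have h6 : ¬ -disp x y = t - 1 := by omega
  have h7 : ¬ -disp x y = 1 - t := by omega
  rw [if_neg h4, if_neg h5, if_neg h6, if_neg h7]
  rw [sgn_comm h1 h4 h5] at h3
  cases a <;> cases b <;> simp at h3 ⊢

/-- The ways in which a vertex colour occurs at a point. -/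
theorem table_eq_inl [NeZero t] {x y k : ZMod (2 * t)} {a b g : Bool}
    (h : table t (x, a) (y, b) = Sum.inl (k, g)) :
    (x ≠ y ∧ disp x y ≠ t ∧ k = apex x y ∧ g = (a ^^ sgn x y) ∧ g = (b ^^ sgn y x)) ∨
      (a = false ∧ b = true ∧ y = x + ((t + 1) / 2 : ℤ) ∧ k = x ∧ g = true) ∨
      (a = true ∧ b = false ∧ y = x - ((t + 1) / 2 : ℤ) ∧ k = y ∧ g = true) := by
  unfold table at h
  simp only at h
  split_ifs at h with h0 h1 h2 h3 h4 h5 ha h6 h6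
  · simp only [Sum.inl.injEq, Prod.mk.injEq] at h
    obtain ⟨rfl, rfl⟩ := h
    exact Or.inl ⟨h0, h1, rfl, rfl, h3⟩
  · simp only [Sum.inl.injEq, Prod.mk.injEq] at h
    obtain ⟨rfl, rfl⟩ := h
    rw [sgn_comm h1 h4 h5, Bool.xor_left_inj] at h3
    subst ha
    refine Or.inr (Or.inr ⟨rfl, ?_, ?_, rfl, rfl⟩)
    · cases b <;> simp at h3 ⊢
    · linear_combination -h6
  · simp only [Sum.inl.injEq, Prod.mk.injEq] at h
    obtain ⟨rfl, rfl⟩ := h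
    rw [sgn_comm h1 h4 h5, Bool.xor_left_inj] at h3
    refine Or.inr (Or.inl ⟨by simpa using ha, ?_, ?_, rfl, rfl⟩)
    · cases a <;> cases b <;> simp at h3 ha ⊢
    · linear_combination h6

/-- The ways in which a colour that is not a vertex colour occurs at a point. -/
theorem table_eq_inr [NeZero t] {x y d : ZMod (2 * t)} {a b : Bool} (hne : (x, a) ≠ (y, b))
    (h : table t (x, a) (y, b) = Sum.inr d) :
    (d = (0 : ℤ) ∧ y = x ∧ b = !a) ∨
      (d = ((t + 1) / 2 : ℤ) ∧ disp x y = t ∧ b = a) ∨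
      (d = (3 * t - cyc t (res (x - 1)) - cyc t (res x) : ℤ) ∧ disp x y = t ∧ b = !a) ∨
      (d = (cyc t (res (x - 1)) : ℤ) ∧ disp x y = t - 1 ∧ b = (!a ^^ sgn x y ^^ sgn y x)) ∨
      (d = (cyc t (res x) : ℤ) ∧ disp x y = 1 - t ∧ b = (!a ^^ sgn x y ^^ sgn y x)) ∨
      (b = (!a) ∧ d = (if a then x - y else y - x) ∧ d ≠ (0 : ℤ) ∧ d ≠ ((t + 1) / 2 : ℤ) ∧
        d ≠ (t - 1 : ℤ) ∧ d ≠ (t : ℤ) ∧ d ≠ (t + 1 : ℤ)) := by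
  have hxor : ∀ a b s s' : Bool, ¬ (a ^^ s) = (b ^^ s') → b = (!a ^^ s ^^ s') := by decide
  have hnot : ∀ a b : Bool, ¬ a = b → b = !a := by decide
  unfold table at h
  simp only at h
  by_cases h0 : x = y
  · rw [if_pos h0, Sum.inr.injEq] at h
    exact Or.inl ⟨h.symm, h0.symm, hnot _ _ fun ha => hne (by rw [h0, ha])⟩
  rw [if_neg h0] at h
  by_cases h1 : disp x y = t
  · rw [if_pos h1] at h
    split_ifs at h with h2
    · exact Or.inr (Or.inl ⟨(Sum.inr_injective h).symm, h1, h2.symm⟩)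
    · exact Or.inr (Or.inr (Or.inl ⟨(Sum.inr_injective h).symm, h1, hnot _ _ h2⟩))
  rw [if_neg h1] at h
  by_cases h3 : (a ^^ sgn x y) = (b ^^ sgn y x)
  · simp [if_pos h3] at h
  rw [if_neg h3] at h
  by_cases h4 : disp x y = t - 1
  · rw [if_pos h4, Sum.inr.injEq] at h
    exact Or.inr (Or.inr (Or.inr (Or.inl ⟨h.symm, h4, hxor _ _ _ _ h3⟩)))
  rw [if_neg h4] at h
  by_cases h5 : disp x y = 1 - t
  · rw [if_pos h5, Sum.inr.injEq] at h
    exact Or.inr (Or.inr (Or.inr (Or.inr (Or.inl ⟨h.symm, h5, hxor _ _ _ _ h3⟩))))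
  rw [if_neg h5] at h
  by_cases h6 : (if a then x - y else y - x) = (((t + 1) / 2 : ℤ) : ZMod (2 * t))
  · simp [if_pos h6] at h
  rw [if_neg h6, Sum.inr.injEq] at h
  have hb := disp_bounds x y
  have hb' := disp_bounds y x
  have hs := disp_swap h1
  have h7 : disp x y ≠ 0 := fun h => h0 (disp_eq_zero.1 h)
  have h8 : ∃ e : ℤ, d = (e : ZMod (2 * t)) ∧ e ≠ 0 ∧ e ≠ t ∧ e ≠ t - 1 ∧ e ≠ 1 - t ∧ -t < e ∧
      e ≤ t := by
    cases a
    · refine ⟨disp x y, ?_, h7, h1, h4, h5, hb⟩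
      rw [cast_disp, ← h]
      rfl
    · refine ⟨disp y x, ?_, by omega, by omega, by omega, by omega, hb'⟩
      rw [cast_disp, ← h]
      rfl
  obtain ⟨e, he, e0, e1, e2, e3, e4, e5⟩ := h8
  have hN : ((2 * t : ℤ) : ZMod (2 * t)) = 0 := by
    push_cast
    linear_combination half_add_half (t := t)
  rw [sgn_comm h1 h4 h5, Bool.xor_left_inj] at h3
  refine Or.inr (Or.inr (Or.inr (Or.inr (Or.inr
    ⟨hnot _ _ h3, h.symm, ?_, h ▸ h6, ?_, ?_, ?_⟩)))) <;> intro h' <;> rw [he] at h'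
  · exact e0 (intCast_inj h' (by omega) (by omega))
  · exact e2 (intCast_inj h' (by omega) (by omega))
  · exact e1 (intCast_inj h' (by omega) (by omega))
  · have h9 : ((e + 2 * t : ℤ) : ZMod (2 * t)) = (t + 1 : ℤ) := by
      rw [Int.cast_add, hN, add_zero, h']
    have := intCast_inj h9 (by omega) (by omega)
    omega

/-- A vertex lies between `0` and `t` steps ahead of any vertex colour it sees; the two extreme
cases carry the information on bits that harmony needs. -/
theorem exists_offset_of_table_eq_inl [NeZero t] (ht : 2 ≤ t) {x y k : ZMod (2 * t)} {a b g : Bool}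
    (h : table t (x, a) (y, b) = Sum.inl (k, g)) :
    ∃ j : ℤ, x - k = (j : ZMod (2 * t)) ∧ 0 ≤ j ∧ j ≤ t ∧ (j = 0 → a = false ∧ g = true) ∧
      (j = t → g = (a ^^ decide (k.val < t))) := by
  rcases table_eq_inl h with ⟨h0, h1, rfl, hg, -⟩ | ⟨rfl, -, -, rfl, rfl⟩ | ⟨rfl, -, rfl, rfl, rfl⟩
  · have hb := disp_bounds x y
    refine ⟨offset t (disp x y), by rw [apex]; ring, ?_, ?_, ?_, ?_⟩
    · unfold offset
      omega
    · unfold offset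
      omega
    · unfold offset
      omega
    · intro hj
      have : disp x y = 1 - t := by
        unfold offset at hj
        omega
      rw [hg, sgn, if_pos this]
  · exact ⟨0, by simp, le_rfl, by omega, fun _ => ⟨rfl, rfl⟩, by omega⟩
  · exact ⟨(t + 1) / 2, by ring, by omega, by omega, by omega, by omega⟩

/-- For two vertices seeing each other the offsets sum to zero modulo `2 * t`, so both are `0` or
both are `t`. The first is excluded by the bits. In the second the points are antipodal, and exactly
one has value below `t`, so the tie-break contradicts itself. -/
theorem table_harm [NeZero t] (ht : 2 ≤ t) {u u' w w' : ZMod (2 * t) × Bool}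
    (h : table t u u' = Sum.inl w) : table t w w' ≠ Sum.inl u := by
  intro h'
  obtain ⟨j, hj, h0, h1, h2, h3⟩ := exists_offset_of_table_eq_inl ht h
  obtain ⟨i, hi, h0', h1', h2', h3'⟩ := exists_offset_of_table_eq_inl ht h'
  have hsum : ((i + j : ℤ) : ZMod (2 * t)) = (0 : ℤ) := by
    push_cast
    rw [← hi, ← hj]
    ring
  by_cases hlt : i + j < 2 * t
  · have := intCast_inj hsum (by omega) (by omega)
    have hu := (h2 (by omega)).1
    rw [(h2' (by omega)).2] at hu
    exact absurd hu (by decide)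
  · have e1 := h3 (by omega)
    have e2 := h3' (by omega)
    rw [show j = t by omega] at hj
    push_cast at hj
    have hv := val_lt_add_half w.1
    rw [← hj, add_sub_cancel] at hv
    rw [e1] at e2
    simp only [hv] at e2
    revert e2
    generalize u.2 = p
    by_cases hw : w.1.val < t <;> cases p <;> simp [hw]

theorem apex_ne [NeZero t] {x y : ZMod (2 * t)} (h1 : disp x y ≠ t) :
    x ≠ apex x y := by
  intro h
  have hb := disp_bounds x y
  have : ((offset t (disp x y) : ℤ) : ZMod (2 * t)) = (0 : ℤ) := by
    rw [apex] at h
    push_cast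
    linear_combination h
  have := intCast_inj this (by unfold offset; omega) (by unfold offset; omega)
  unfold offset at this
  omega

/-- Displacement `0` does not occur, so offset `(t + 1) / 2` leaves only an odd displacement. Hence
`(x, true)` does not see the colour `(x - (t + 1) / 2, true)` through an apex, and the diverted edge
can take it. -/
theorem sgn_eq_true_of_apex_eq [NeZero t] (ht : 4 ≤ t) {x y : ZMod (2 * t)} (h0 : x ≠ y)
    (h : x - apex x y = ((t + 1) / 2 : ℤ)) : sgn x y = true := by
  have hb := disp_bounds x y
  have : ((offset t (disp x y) : ℤ) : ZMod (2 * t)) = ((t + 1) / 2 : ℤ) := by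
    rw [apex] at h
    linear_combination h
  have := intCast_inj this (by unfold offset; omega) (by unfold offset; omega)
  have h2 : disp x y ≠ 0 := fun h => h0 (disp_eq_zero.1 h)
  unfold offset at this
  rw [sgn, if_neg (by omega), decide_eq_true_iff]
  omega

theorem table_proper_inl [NeZero t] (ht : 4 ≤ t) {x y z k : ZMod (2 * t)} {a b c g : Bool}
    (hv : table t (x, a) (y, b) = Sum.inl (k, g)) (hw : table t (x, a) (z, c) = Sum.inl (k, g)) :
    (y, b) = (z, c) := by
  have hX : ∀ {p q : ZMod (2 * t)}, k = q → q = p - ((t + 1) / 2 : ℤ) → p - k = ((t + 1) / 2 : ℤ) := by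
    rintro p q rfl h
    rw [h]
    ring
  have hS : ∀ {s : Bool}, g = (a ^^ s) → a = true → g = true → s ≠ true := by
    rintro s rfl rfl h
    simpa using h
  rcases table_eq_inl hv with ⟨h0, h1, h2, h3, h4⟩ | ⟨h1, h2, h3, h4, h5⟩ | ⟨h1, h2, h3, h4, h5⟩ <;>
    rcases table_eq_inl hw with ⟨e0, e1, e2, e3, e4⟩ | ⟨e1, e2, e3, e4, e5⟩ | ⟨e1, e2, e3, e4, e5⟩
  · have hb := disp_bounds x y
    have hb' := disp_bounds x z
    have hoff : ((offset t (disp x y) : ℤ) : ZMod (2 * t)) = (offset t (disp x z) : ℤ) := by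
      have := h2.symm.trans e2
      rw [apex, apex] at this
      linear_combination -this
    have hoff := intCast_inj hoff (by unfold offset; omega) (by unfold offset; omega)
    have hs : sgn x y = sgn x z := Bool.xor_right_inj.1 (h3.symm.trans e3)
    have hd : disp x y = disp x z := by
      unfold offset at hoff
      by_cases h1 : disp x y = 1 - t
      · omega
      · rw [sgn, sgn, if_neg h1, if_neg (by omega), decide_eq_decide] at hs
        omega
    obtain rfl := eq_of_disp_eq hd
    rw [Bool.xor_left_inj.1 (h4.symm.trans e4)]
  · exact absurd (e4.symm.trans h2) (apex_ne h1)
  · exact absurd (sgn_eq_true_of_apex_eq ht h0 (h2 ▸ hX e4 e3)) (hS h3 e1 e5)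
  · exact absurd (h4.symm.trans e2) (apex_ne e1)
  · rw [h2, h3, e2, e3]
  · exact absurd (h1.symm.trans e1) (by decide)
  · exact absurd (sgn_eq_true_of_apex_eq ht e0 (e2 ▸ hX h4 h3)) (hS e3 h1 h5)
  · exact absurd (h1.symm.trans e1) (by decide)
  · rw [h2, h3, e2, e3]

/-- The residues `0`, `(t + 1) / 2`, `t - 1`, `t`, `t + 1` are distinct because `t ≥ 4`; for `t = 2,
3` the second equals `t - 1`. Among the last three, `cyc_res_ne` keeps the edges of displacement `t
- 1`, `t`, `1 - t` at a vertex apart. -/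
theorem table_proper_inr [NeZero t] (ht : 4 ≤ t) {x y z d : ZMod (2 * t)} {a b c : Bool}
    (hy : (x, a) ≠ (y, b)) (hz : (x, a) ≠ (z, c)) (hv : table t (x, a) (y, b) = Sum.inr d)
    (hw : table t (x, a) (z, c) = Sum.inr d) : (y, b) = (z, c) := by
  have hp := cyc_mem t (res (x - 1))
  have hq := cyc_mem t (res x)
  have hpq := cyc_res_ne (by omega) x
  have hdisp : ∀ {e : ℤ}, disp x y = e → disp x z = e → y = z :=
    fun h h' => eq_of_disp_eq (h.trans h'.symm)
  have hcast : ∀ {e f : ℤ}, d = (e : ZMod (2 * t)) → d = (f : ZMod (2 * t)) → 0 ≤ e → e < 2 * t →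
      0 ≤ f → f < 2 * t → e = f :=
    fun h h' _ _ _ _ => intCast_inj (h.symm.trans h') (by omega) (by omega)
  have hK : ∀ {e : ℤ}, d = (e : ZMod (2 * t)) → (e = t - 1 ∨ e = t ∨ e = t + 1) →
      d = (t - 1 : ℤ) ∨ d = (t : ℤ) ∨ d = (t + 1 : ℤ) := by
    rintro e h (rfl | rfl | rfl) <;> simp [h]
  rcases table_eq_inr hy hv with ⟨h1, h2, h3⟩ | ⟨h1, h2, h3⟩ | ⟨h1, h2, h3⟩ | ⟨h1, h2, h3⟩ |
      ⟨h1, h2, h3⟩ | ⟨h1, h2, h3, h4, h5, h6, h7⟩ <;>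
    rcases table_eq_inr hz hw with ⟨e1, e2, e3⟩ | ⟨e1, e2, e3⟩ | ⟨e1, e2, e3⟩ | ⟨e1, e2, e3⟩ |
      ⟨e1, e2, e3⟩ | ⟨e1, e2, e3, e4, e5, e6, e7⟩
  case inl.inl => rw [h2, h3, e2, e3]
  case inr.inl.inr.inl => rw [hdisp h2 e2, h3, e3]
  case inr.inr.inl.inr.inr.inl => rw [hdisp h2 e2, h3, e3]
  case inr.inr.inr.inl.inr.inr.inr.inl =>
    obtain rfl := hdisp h2 e2
    rw [h3, e3]
  case inr.inr.inr.inr.inl.inr.inr.inr.inr.inl =>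
    obtain rfl := hdisp h2 e2
    rw [h3, e3]
  case inr.inr.inr.inr.inr.inr.inr.inr.inr.inr =>
    have h := h2.symm.trans e2
    rw [h1, e1]
    cases a
    · rw [sub_left_injective h]
    · rw [sub_right_injective h]
  all_goals first
    | exact absurd (hcast h1 e1 (by omega) (by omega) (by omega) (by omega)) (by omega)
    | exact absurd h1 e3
    | exact absurd e1 h3
    | exact absurd h1 e4
    | exact absurd e1 h4
    | exact ((hK h1 (by omega)).elim e5 fun h => h.elim e6 e7 : False).elim
    | exact ((hK e1 (by omega)).elim h5 fun h => h.elim h6 h7 : False).elim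

theorem nonempty_colouring {t : ℕ} (ht : 4 ≤ t) :
    Nonempty (HarmoniousTotalColouring (SimpleGraph.completeGraph (Fin (4 * t))) (Fin (6 * t))) := by
  have : NeZero t := ⟨by omega⟩
  refine nonempty_colouring_of_table (V := ZMod (2 * t) × Bool) (X := ZMod (2 * t)) ?_ ?_
    (table t) table_comm ?_ ?_ ?_
  · rw [Fintype.card_prod, ZMod.card, Fintype.card_bool]
    ring
  · rw [Fintype.card_prod, ZMod.card, Fintype.card_bool]
    ring
  · rintro ⟨x, a⟩ ⟨y, b⟩ hne h
    obtain ⟨j, hj, h0, h1, h2, -⟩ := exists_offset_of_table_eq_inl (by omega) h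
    have := intCast_inj (t := t) (a := j) (b := 0) (by rw [← hj]; simp) (by omega) (by omega)
    obtain ⟨rfl, h⟩ := h2 this
    exact absurd h (by decide)
  · rintro ⟨x, a⟩ ⟨y, b⟩ ⟨z, c⟩ hy hz h
    rcases hc : table t (x, a) (z, c) with ⟨k, g⟩ | d
    · exact table_proper_inl ht (h.trans hc) hc
    · exact table_proper_inr ht hy hz (h.trans hc) hc
  · exact fun u u' w w' _ _ h => table_harm (by omega) h

end CyclicTable

/-! ### The value of the harmonious total chromatic number. -/

theorem harmoniousTotalChromaticNumber_eq {V : Type*} {G : SimpleGraph V} {N : ℕ}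
    (h : Nonempty (HarmoniousTotalColouring G (Fin N)))
    (hle : ∀ k, HarmoniousTotalColouring G (Fin k) → N ≤ k) :
    harmoniousTotalChromaticNumber G = N :=
  le_antisymm (iInf₂_le N h) (le_iInf₂ fun k ⟨c⟩ => Nat.cast_le.2 (hle k c))

theorem ceil_three_halves_mul (n : ℕ) : ⌈(3 / 2 : ℚ) * n⌉₊ = (3 * n + 1) / 2 := by
  obtain ⟨r, rfl | rfl⟩ := Nat.even_or_odd' n
  · rw [show (3 / 2 : ℚ) * ((2 * r : ℕ) : ℚ) = ((3 * r : ℕ) : ℚ) by push_cast; ring, Nat.ceil_natCast]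
    omega
  · rw [show (3 * (2 * r + 1) + 1) / 2 = 3 * r + 2 by omega, Nat.ceil_eq_iff (by omega)]
    push_cast
    constructor <;> linarith

theorem nonempty_colouring_completeGraph {n : ℕ} (h1 : n ≠ 1) (h4 : n ≠ 4) :
    Nonempty (HarmoniousTotalColouring (SimpleGraph.completeGraph (Fin n))
      (Fin ((3 * n + 1) / 2))) := by
  obtain rfl | h0 := Nat.eq_zero_or_pos n
  · exact nonempty_colouring_of_table (V := Fin 0) (X := Fin 0) (by simp) (by simp)
      (fun u _ => u.elim0) (fun u => u.elim0) (fun u => u.elim0) (fun u => u.elim0)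
      (fun u => u.elim0)
  obtain ⟨r, hr⟩ : ∃ r, n = 4 * r ∨ n = 4 * r + 1 ∨ n = 4 * r + 2 ∨ n = 4 * r + 3 :=
    ⟨n / 4, by omega⟩
  obtain ⟨S⟩ := MidpointSystem.exists_of_odd (m := 2 * r + 1) ⟨r, rfl⟩
  rcases hr with rfl | rfl | rfl | rfl
  · rw [show (3 * (4 * r) + 1) / 2 = 6 * r by omega]
    obtain rfl | rfl | hr : r = 2 ∨ r = 3 ∨ 4 ≤ r := by omega
    · exact nonempty_colouring_eight
    · exact nonempty_colouring_twelve
    · exact CyclicTable.nonempty_colouring hr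
  · have : NeZero (2 * r) := ⟨by omega⟩
    exact S.nonempty_colouring_merge (m := 2 * r) (ZMod.card _) (by ring) (by omega)
  · refine S.nonempty_colouring ?_ ?_ <;> rw [ZMod.card] <;> omega
  · refine S.nonempty_colouring_add ?_ ?_ <;> rw [ZMod.card] <;> omega

theorem theorem2 :
    (∀ n : ℕ, n ≠ 1 → n ≠ 4 →
      harmoniousTotalChromaticNumber (SimpleGraph.completeGraph (Fin n)) =
        ((⌈(3 / 2 : ℚ) * (n : ℚ)⌉₊ : ℕ) : ℕ∞)) ∧
    harmoniousTotalChromaticNumber (SimpleGraph.completeGraph (Fin 1)) = 1 ∧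
    harmoniousTotalChromaticNumber (SimpleGraph.completeGraph (Fin 4)) = 7 := by
  refine ⟨fun n h1 h4 => ?_, ?_, ?_⟩
  · rw [ceil_three_halves_mul]
    refine harmoniousTotalChromaticNumber_eq (nonempty_colouring_completeGraph h1 h4) fun k c => ?_
    obtain rfl | hn : n = 0 ∨ 2 ≤ n := by omega
    · exact Nat.zero_le k
    · exact c.three_mul_le hn
  · refine harmoniousTotalChromaticNumber_eq (N := 1) ?_ fun k c => c.card_le
    exact nonempty_colouring_of_table (V := Fin 1) (X := Fin 0) (by simp) (by simp)
      (fun u _ => Sum.inl u) (by decide) (by decide) (by decide) (by decide)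
  · exact harmoniousTotalChromaticNumber_eq (N := 7) nonempty_colouring_four
      fun k c => six_lt_of_colouring_four c
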